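/- Consider a first-price auction with $n\ge 2$ bidders. Bidder $i$ has a private value in a set $T_i$ with $\{0,1\}\subseteq T_i\subseteq[0,H]$ and bids in $[0,H]$. The highest bidder wins the item, with ties broken uniformly at random, and pays her bid, so under bids $b$ bidder $i$ with value $v_i$ has ex post utility $u_i(v_i,b)=(v_i-b_i)\,x_i(b)$, where $x_i(b)=1/|\arg\max_j b_j|$ if $b_i=\max_j b_j$ and $x_i(b)=0$ otherwise. A joint bidding strategy $s=(s_1,\dots,s_n)$, $s_i:T_i\to[0,H]$, is monotone if every $s_i$ is weakly increasing. For a product value distribution $F=\prod_{i=1}^n F_i$ on $\prod_{i=1}^n T_i$, the interim utility of bidder $i$ with value $v_i$ is $$U_i^F(v_i,s)=\mathbb E_{v_{-i}\sim F_{-i}}\big[u_i\big(v_i,(s_i(v_i),s_{-i}(v_{-i}))\big)\big].$$ A utility estimation algorithm with $m$ samples is a function $\mathcal A$ that assigns a real number $\mathcal A(S,i,v_i,s)$ to every $S\in(\prod_{i} T_i)^m$, bidder $i$, value $v_i\in T_i$ and joint strategy $s$. It $(\varepsilon,\delta)$-estimates the utilities of all monotone strategies on a family $\mathcal F$ of product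 value distributions if for every $F\in\mathcal F$, with probability at least $1-\delta$ over $m$ i.i.d. samples $S$ from $F$, one has $|\mathcal A(S,i,v_i,s)-U_i^F(v_i,s)|<\varepsilon$ for all monotone $s$, all bidders $i$ and all $v_i\in T_i$ simultaneously. **Theorem.** Let $0<\varepsilon<\frac1{4000}$ and $0<\delta<\frac1{20}$. Then there is a family $\mathcal F$ of product value distributions, in each of which every bidder's value is $0$ or $1$ almost surely, such that for every integer $m\ge 0$ with $$m\le\frac{1}{4\times10^8}\cdot\frac{n}{\varepsilon^2},$$ no utility estimation algorithm with $m$ samples $(\varepsilon,\delta)$-estimates the utilities of all monotone strategies on $\mathcal F$. -/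

import Mathlib

open MeasureTheory

noncomputable section

namespace FirstPrice

variable {n : ℕ}

/-- Allocation rule: the highest bidder wins, ties broken uniformly at random. `alloc b i` is the
probability with which bidder `i` receives the item when the bids are `b`. -/
def alloc (b : Fin n → ℝ) (i : Fin n) : ℝ :=
  if ∀ j, b j ≤ b i then 1 / ((Finset.univ.filter fun k => ∀ j, b j ≤ b k).card : ℝ) else 0

/-- First-price payment: the winner pays her own bid, the others pay nothing. -/
def payment (b : Fin n → ℝ) (i : Fin n) : ℝ := alloc b i * b i

/-- Ex post utility of bidder `i` with value `v` under the bids `b`. -/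
def exPostUtility (i : Fin n) (v : ℝ) (b : Fin n → ℝ) : ℝ := v * alloc b i - payment b i

/-- The values of all bidders, bidder `i` having value space `T i`. -/
abbrev Values (T : Fin n → Set ℝ) : Type := ∀ i, T i

/-- Joint (pure) bidding strategies: bidder `i` maps her value in `T i` to a bid in `[0, H]`. -/
abbrev JointStrategy (T : Fin n → Set ℝ) (H : ℝ) : Type := ∀ i, T i → Set.Icc (0 : ℝ) H

/-- A product value distribution, given by its marginals. -/
abbrev Marginals (T : Fin n → Set ℝ) : Type := ∀ i, ProbabilityMeasure (T i)

variable {T : Fin n → Set ℝ} {H : ℝ}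

/-- The set of all monotone (weakly increasing) joint bidding strategies. -/
def monotoneStrategies (T : Fin n → Set ℝ) (H : ℝ) : Set (JointStrategy T H) :=
  {s | ∀ i, Monotone (s i)}

/-- The joint value distribution `∏ i, F i`. -/
def jointDist (F : Marginals T) : Measure (Values T) :=
  Measure.pi fun i => (F i : Measure (T i))

/-- The distribution `∏ j ≠ i, F j` of the values of the opponents of bidder `i`. -/
def opponentsDist (F : Marginals T) (i : Fin n) : Measure (∀ j : {j : Fin n // j ≠ i}, T j) :=
  Measure.pi fun j => (F j : Measure (T j))

/-- The bids when bidder `i` bids `b` and her opponents bid according to `s` at values `w`. -/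
def bidsAgainst (i : Fin n) (b : ℝ) (s : JointStrategy T H)
    (w : ∀ j : {j : Fin n // j ≠ i}, T j) : Fin n → ℝ :=
  fun j => if h : j = i then b else (s j (w ⟨j, h⟩) : ℝ)

/-- Interim utility of bidder `i` with value `v` and bid `b` when her opponents use `s`
(the entry `s i` is not used). -/
def interimUtility (F : Marginals T) (i : Fin n) (v b : ℝ) (s : JointStrategy T H) : ℝ :=
  ∫ w, exPostUtility i v (bidsAgainst i b s w) ∂(opponentsDist F i)

/-- A utility estimation algorithm on `m` samples: from the samples, a bidder, her value and all
bidders' strategies it computes an estimate of the bidder's interim utility. -/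
abbrev UtilityEstimator (T : Fin n → Set ℝ) (H : ℝ) (m : ℕ) : Type :=
  (Fin m → Values T) → ∀ i : Fin n, T i → JointStrategy T H → ℝ

/-- The samples on which the estimates of `A` are within `ε` of the interim utilities under the
value distribution `∏ i, F i`, simultaneously for all strategies in `B`, bidders and values. -/
def goodSamples {m : ℕ} (A : UtilityEstimator T H m) (B : Set (JointStrategy T H)) (ε : ℝ)
    (F : Marginals T) : Set (Fin m → Values T) :=
  {S | ∀ s ∈ B, ∀ (i : Fin n) (v : T i),
    |A S i v s - interimUtility F i v (s i v) s| < ε}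

/-- `A` `(ε, δ)`-estimates with `m` samples the utilities over `B`, for every product value
distribution in the family `𝓕`: if the `m` samples are drawn independently from the distribution,
then all the estimates are within `ε` with probability at least `1 - δ`. -/
def EstimatesUtilities {m : ℕ} (A : UtilityEstimator T H m) (𝓕 : Set (Marginals T))
    (B : Set (JointStrategy T H)) (ε δ : ℝ) : Prop :=
  ∀ F ∈ 𝓕, ENNReal.ofReal (1 - δ) ≤
    (Measure.pi fun _ : Fin m => jointDist F) (goodSamples A B ε F)

/-- Every bidder's value is `0` or `1` almost surely. -/
def IsBernoulliType (F : Marginals T) : Prop :=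
  ∀ i, ∀ᵐ v : T i ∂(F i : Measure (T i)), (v : ℝ) = 0 ∨ (v : ℝ) = 1

end FirstPrice

end

/-! The hard family gives each bidder value `1` with probability `(1/2 ± θ)/n`, `θ = 400ε`, the
signs forming an unknown vector `σ`. A bidder with value `1` who bids `1/2` while the bidders in `J`
bid their value and all others bid `0` has utility `1/2 * ∏ j ∈ J, (1 - p j)`
(`interimUtility_thresholdStrategy`). If two sign vectors disagree in the same direction on all of
`J`, these products differ by at least `|J| θ / (2n)`. Estimates accurate for every `J` therefore
pin `σ` down up to `n/25` coordinates (`card_ne_le_of_mem_goodSamples`).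

Yet one flipped sign lowers the affinity of a single sample by at most `4θ²/n`. With `m` of order at
most `n/ε²`, neighbouring sample laws remain nearly indistinguishable, and `assouad` makes every
decoder err in nearly a quarter of the coordinates on average over `σ`. The two bounds conflict. -/

namespace FirstPrice

/-! ### Coin samples and their Hellinger affinity -/

/-- The probabilities of a biased coin showing `true` with probability `p`. -/
def coinMass (p : ℝ) (b : Bool) : ℝ := if b then p else 1 - p

/-- The probability of `m` independent rounds of independent coins with biases `p`. -/
def sampleMass {ι κ : Type*} [Fintype ι] [Fintype κ] (p : ι → ℝ) (S : κ → ι → Bool) : ℝ :=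
  ∏ k, ∏ j, coinMass (p j) (S k j)

lemma coinMass_nonneg {p : ℝ} (h0 : 0 ≤ p) (h1 : p ≤ 1) (b : Bool) : 0 ≤ coinMass p b := by
  cases b <;> simp [coinMass, h0, h1]

lemma sampleMass_nonneg {ι κ : Type*} [Fintype ι] [Fintype κ] {p : ι → ℝ}
    (h0 : ∀ j, 0 ≤ p j) (h1 : ∀ j, p j ≤ 1) (S : κ → ι → Bool) : 0 ≤ sampleMass p S :=
  Finset.prod_nonneg fun _ _ => Finset.prod_nonneg fun j _ => coinMass_nonneg (h0 j) (h1 j) _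

lemma sum_prod_prod_eq_pow {ι κ : Type*} [Fintype ι] [Fintype κ] [DecidableEq ι] [DecidableEq κ]
    (f : ι → Bool → ℝ) :
    ∑ S : κ → ι → Bool, ∏ k, ∏ j, f j (S k j) = (∏ j, ∑ b, f j b) ^ Fintype.card κ := by
  have h1 := Finset.sum_prod_piFinset (ι := κ) (Finset.univ : Finset (ι → Bool))
    (fun _ x => ∏ j, f j (x j))
  have h2 := Finset.sum_prod_piFinset (ι := ι) (Finset.univ : Finset Bool) f
  rw [Fintype.piFinset_univ] at h1 h2
  rw [h1, h2, Finset.prod_const, Finset.card_univ]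

lemma sum_sampleMass {ι κ : Type*} [Fintype ι] [Fintype κ] [DecidableEq ι] [DecidableEq κ]
    (p : ι → ℝ) : ∑ S : κ → ι → Bool, sampleMass p S = 1 := by
  unfold sampleMass
  rw [sum_prod_prod_eq_pow fun j => coinMass (p j)]
  simp [coinMass]

/-- The affinity of two families of coins tensorizes. -/
lemma sum_sqrt_sampleMass_mul {ι κ : Type*} [Fintype ι] [Fintype κ] [DecidableEq ι] [DecidableEq κ]
    {p q : ι → ℝ} (hp0 : ∀ j, 0 ≤ p j) (hp1 : ∀ j, p j ≤ 1) (hq0 : ∀ j, 0 ≤ q j)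
    (hq1 : ∀ j, q j ≤ 1) :
    ∑ S : κ → ι → Bool, √(sampleMass p S * sampleMass q S) =
      (∏ j, ∑ b, √(coinMass (p j) b * coinMass (q j) b)) ^ Fintype.card κ := by
  have hn : ∀ j b, 0 ≤ coinMass (p j) b * coinMass (q j) b := fun j b =>
    mul_nonneg (coinMass_nonneg (hp0 j) (hp1 j) b) (coinMass_nonneg (hq0 j) (hq1 j) b)
  rw [← sum_prod_prod_eq_pow]
  refine Finset.sum_congr rfl fun S _ => ?_
  simp_rw [sampleMass, ← Finset.prod_mul_distrib]
  rw [Real.sqrt_prod _ fun k _ => Finset.prod_nonneg fun j _ => hn j _]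
  exact Finset.prod_congr rfl fun k _ => Real.sqrt_prod _ fun j _ => hn j _

/-- The harmonic mean is at most the geometric mean; this replaces square roots by rational
expressions. -/
lemma div_le_sqrt_mul {x y : ℝ} (hx : 0 ≤ x) (hy : 0 ≤ y) (h : 0 < x + y) :
    2 * (x * y) / (x + y) ≤ √(x * y) := by
  apply Real.le_sqrt_of_sq_le
  rw [div_pow, div_le_iff₀ (by positivity)]
  nlinarith [mul_nonneg (mul_nonneg hx hy) (sq_nonneg (x - y))]

/-- The affinity of two coins with biases `a ± d`. -/
lemma one_sub_le_sum_sqrt_coinMass {a d : ℝ} (ha : 0 < a) (ha' : a ≤ 1 / 2) (hd : |d| ≤ a) :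
    1 - 2 * d ^ 2 / a ≤ ∑ b, √(coinMass (a + d) b * coinMass (a - d) b) := by
  obtain ⟨h1, h2⟩ := abs_le.1 hd
  have e1 := div_le_sqrt_mul (x := a + d) (y := a - d) (by linarith) (by linarith) (by linarith)
  have e2 := div_le_sqrt_mul (x := 1 - (a + d)) (y := 1 - (a - d)) (by linarith) (by linarith)
    (by linarith)
  have f1 : 2 * ((a + d) * (a - d)) / (a + d + (a - d)) = a - d ^ 2 / a := by
    have h : a + d + (a - d) = 2 * a := by ring
    rw [h]; field_simp; ring
  have f2 : 2 * ((1 - (a + d)) * (1 - (a - d))) / (1 - (a + d) + (1 - (a - d))) =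
      1 - a - d ^ 2 / (1 - a) := by
    have : 1 - a ≠ 0 := by linarith
    have h : 1 - (a + d) + (1 - (a - d)) = 2 * (1 - a) := by ring
    rw [h]; field_simp; ring
  have f3 : d ^ 2 / (1 - a) ≤ d ^ 2 / a :=
    div_le_div_of_nonneg_left (sq_nonneg d) ha (by linarith)
  have f4 : 2 * d ^ 2 / a = d ^ 2 / a + d ^ 2 / a := by ring
  rw [f1] at e1
  rw [f2] at e2
  simp only [Fintype.sum_bool, coinMass, if_true, Bool.false_eq_true, if_false]
  linarith

/-- Le Cam's inequality: Cauchy–Schwarz applied to `P * Q = min * max`, where the maxima sum to at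
most `2`. -/
lemma sq_sum_sqrt_le_two_mul_sum_min {X : Type*} [Fintype X] {P Q : X → ℝ} (hP : ∀ x, 0 ≤ P x)
    (hQ : ∀ x, 0 ≤ Q x) (hP1 : ∑ x, P x = 1) (hQ1 : ∑ x, Q x = 1) :
    (∑ x, √(P x * Q x)) ^ 2 ≤ 2 * ∑ x, min (P x) (Q x) := by
  have h := Finset.sum_sq_le_sum_mul_sum_of_sq_le_mul Finset.univ (r := fun x => √(P x * Q x))
    (f := fun x => min (P x) (Q x)) (g := fun x => max (P x) (Q x))
    (fun x _ => le_min (hP x) (hQ x)) (fun x _ => le_max_of_le_left (hP x))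
    (fun x _ => by rw [Real.sq_sqrt (mul_nonneg (hP x) (hQ x)), min_mul_max])
  have h2 : ∑ x, max (P x) (Q x) ≤ 2 := by
    calc ∑ x, max (P x) (Q x) ≤ ∑ x, (P x + Q x) := Finset.sum_le_sum fun x _ =>
          max_le (le_add_of_nonneg_right (hQ x)) (le_add_of_nonneg_left (hP x))
      _ = 2 := by rw [Finset.sum_add_distrib, hP1, hQ1]; norm_num
  have h3 : 0 ≤ ∑ x, min (P x) (Q x) := Finset.sum_nonneg fun x _ => le_min (hP x) (hQ x)
  nlinarith

/-! ### Assouad's lemma -/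

/-- The sign vector `σ` with its coordinate `j` flipped. -/
def flipAt {ι : Type*} [DecidableEq ι] (j : ι) (σ : ι → Bool) : ι → Bool :=
  Function.update σ j (!σ j)

lemma flipAt_involutive {ι : Type*} [DecidableEq ι] (j : ι) :
    Function.Involutive (flipAt j) := fun σ => by
  simp [flipAt]

/-- **Assouad's lemma**: if neighbouring distributions of a family indexed by the hypercube have
affinity at least `c`, every decoder errs in many coordinates on average. -/
lemma assouad {ι X : Type*} [Fintype ι] [DecidableEq ι] [Fintype X] (P : (ι → Bool) → X → ℝ)
    (hP : ∀ σ x, 0 ≤ P σ x) (hP1 : ∀ σ, ∑ x, P σ x = 1) {c : ℝ} (hc : 0 ≤ c)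
    (hPc : ∀ σ j, c ≤ ∑ x, √(P σ x * P (flipAt j σ) x)) (dec : X → ι → Bool) (s : Finset ι) :
    Fintype.card (ι → Bool) * (s.card * (c ^ 2 / 4)) ≤
      ∑ σ, ∑ x, P σ x * (s.filter fun j => dec x j ≠ σ j).card := by
  have key : ∀ j, Fintype.card (ι → Bool) * (c ^ 2 / 4) ≤
      ∑ σ, ∑ x, P σ x * (if dec x j ≠ σ j then 1 else 0) := by
    intro j
    -- Averaging over `σ` is invariant under the flip, so each `σ` can be paired with its neighbour.
    have hflip : ∑ σ, ∑ x, P σ x * (if dec x j ≠ σ j then 1 else 0) =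
        ∑ σ, ∑ x, P (flipAt j σ) x * (if dec x j ≠ flipAt j σ j then (1 : ℝ) else 0) :=
      (Equiv.sum_comp (flipAt_involutive j).toPerm
        fun σ => ∑ x, P σ x * (if dec x j ≠ σ j then (1 : ℝ) else 0)).symm
    have hsum : ∑ _σ : ι → Bool, c ^ 2 / 2 ≤
        ∑ σ, ∑ x, P σ x * (if dec x j ≠ σ j then 1 else 0) +
        ∑ σ, ∑ x, P (flipAt j σ) x * (if dec x j ≠ flipAt j σ j then (1 : ℝ) else 0) := by
      rw [← Finset.sum_add_distrib]
      refine Finset.sum_le_sum fun σ _ => ?_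
      rw [← Finset.sum_add_distrib]
      have h1 := sq_sum_sqrt_le_two_mul_sum_min (hP σ) (hP (flipAt j σ)) (hP1 _) (hP1 _)
      have h2 := pow_le_pow_left₀ hc (hPc σ j) 2
      -- The decoded bit is wrong for exactly one of `σ` and its flip, so one of the two masses is
      -- always charged.
      have h3 : ∑ x, min (P σ x) (P (flipAt j σ) x) ≤
          ∑ x, (P σ x * (if dec x j ≠ σ j then 1 else 0) +
            P (flipAt j σ) x * (if dec x j ≠ flipAt j σ j then (1 : ℝ) else 0)) := by
        refine Finset.sum_le_sum fun x _ => ?_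
        have : flipAt j σ j = !σ j := by simp [flipAt]
        rw [this]
        cases dec x j <;> cases σ j <;> simp
      linarith
    rw [← hflip, Finset.sum_const, Finset.card_univ, nsmul_eq_mul] at hsum
    linarith
  calc (Fintype.card (ι → Bool) : ℝ) * (s.card * (c ^ 2 / 4))
      = ∑ _j ∈ s, Fintype.card (ι → Bool) * (c ^ 2 / 4) := by
        rw [Finset.sum_const, nsmul_eq_mul]; ring
    _ ≤ ∑ j ∈ s, ∑ σ, ∑ x, P σ x * (if dec x j ≠ σ j then 1 else 0) :=
        Finset.sum_le_sum fun j _ => key j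
    _ = _ := by
        rw [Finset.sum_comm]
        refine Finset.sum_congr rfl fun σ _ => ?_
        rw [Finset.sum_comm]
        refine Finset.sum_congr rfl fun x _ => ?_
        rw [← Finset.mul_sum, Finset.sum_boole]

lemma div_four_mul_le_pow_sub_pow {a b : ℝ} {n k : ℕ} (hab : b ≤ a) (hb : 0 ≤ b) (hb1 : b ≤ 1)
    (hbn : 1 / 4 ≤ b ^ n) (hk : k ≤ n) : k / 4 * (a - b) ≤ a ^ k - b ^ k := by
  rw [← geom_sum₂_mul]
  refine mul_le_mul_of_nonneg_right ?_ (by linarith)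
  have : ∀ i ∈ Finset.range k, (1 : ℝ) / 4 ≤ a ^ i * b ^ (k - 1 - i) := by
    intro i hi
    rw [Finset.mem_range] at hi
    calc (1 : ℝ) / 4 ≤ b ^ n := hbn
      _ ≤ b ^ (i + (k - 1 - i)) := pow_le_pow_of_le_one hb hb1 (by omega)
      _ = b ^ i * b ^ (k - 1 - i) := pow_add ..
      _ ≤ _ := by gcongr
  calc (k : ℝ) / 4 = ∑ _i ∈ Finset.range k, (1 : ℝ) / 4 := by simp; ring
    _ ≤ _ := Finset.sum_le_sum this

/-! ### The hard biases -/

/-- The probability of value `1` under the sign `b`: `(1/2 ± θ) / n`. -/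
noncomputable def bias (n : ℕ) (θ : ℝ) (b : Bool) : ℝ := (1 / 2 + if b then θ else -θ) / n

lemma bias_nonneg {n : ℕ} {θ : ℝ} (h0 : 0 ≤ θ) (h1 : θ ≤ 1 / 4) (b : Bool) : 0 ≤ bias n θ b := by
  unfold bias
  apply div_nonneg _ (Nat.cast_nonneg n)
  split_ifs <;> linarith

lemma bias_le_one {n : ℕ} (hn : 1 ≤ n) {θ : ℝ} (h0 : 0 ≤ θ) (h1 : θ ≤ 1 / 4) (b : Bool) :
    bias n θ b ≤ 1 := by
  have : (1 : ℝ) ≤ n := by exact_mod_cast hn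
  unfold bias
  rw [div_le_one (by linarith)]
  split_ifs <;> linarith

lemma affinity_bias {n : ℕ} (hn : 1 ≤ n) {θ : ℝ} (h0 : 0 ≤ θ) (h1 : θ ≤ 1 / 4) (b : Bool) :
    1 - 4 * θ ^ 2 / n ≤ ∑ x, √(coinMass (bias n θ b) x * coinMass (bias n θ !b) x) := by
  have hn' : (1 : ℝ) ≤ n := by exact_mod_cast hn
  have key : ∀ t : ℝ, |t| = θ → 1 - 4 * θ ^ 2 / n ≤
      ∑ x, √(coinMass ((1 / 2 + t) / n) x * coinMass ((1 / 2 + -t) / n) x) := by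
    intro t ht
    have h := one_sub_le_sum_sqrt_coinMass (a := 1 / 2 / n) (d := t / n) (by positivity)
      (div_le_self (by norm_num) hn')
      (by rw [abs_div, ht, abs_of_pos (by linarith : (0 : ℝ) < n)]; gcongr; linarith)
    have e : 2 * (t / n) ^ 2 / (1 / 2 / n) = 4 * θ ^ 2 / n := by
      rw [← ht, sq_abs]; field_simp; ring
    rw [e] at h
    rwa [add_div, add_div, neg_div, ← sub_eq_add_neg]
  cases b
  · simpa [bias] using key (-θ) (by rw [abs_neg, abs_of_nonneg h0])
  · simpa [bias] using key θ (abs_of_nonneg h0)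

/-- Coordinates other than `j` have affinity `1`, and Bernoulli's inequality handles the `m`-th
power of the remaining factor. -/
lemma affinity_sampleMass {n m : ℕ} (hn : 1 ≤ n) {θ : ℝ} (h0 : 0 ≤ θ) (h1 : θ ≤ 1 / 4)
    (σ : Fin n → Bool) (j : Fin n) :
    1 - m * (4 * θ ^ 2 / n) ≤ ∑ S : Fin m → Fin n → Bool,
      √(sampleMass (fun i => bias n θ (σ i)) S *
        sampleMass (fun i => bias n θ (flipAt j σ i)) S) := by
  have hb0 := fun b => bias_nonneg (n := n) h0 h1 b
  have hb1 := fun b => bias_le_one hn h0 h1 b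
  rw [sum_sqrt_sampleMass_mul (fun _ => hb0 _) (fun _ => hb1 _) (fun _ => hb0 _) (fun _ => hb1 _),
    Finset.prod_eq_single j, Fintype.card_fin]
  · have hj : flipAt j σ j = !σ j := by simp [flipAt]
    rw [hj]
    have hn' : (1 : ℝ) ≤ n := by exact_mod_cast hn
    have hs : 4 * θ ^ 2 / n ≤ 1 := by rw [div_le_one (by linarith)]; nlinarith
    calc 1 - m * (4 * θ ^ 2 / n) = 1 + m * (-(4 * θ ^ 2 / n)) := by ring
      _ ≤ (1 + -(4 * θ ^ 2 / n)) ^ m := one_add_mul_le_pow (by linarith) m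
      _ ≤ _ := pow_le_pow_left₀ (by linarith) (by
        rw [← sub_eq_add_neg]; exact affinity_bias hn h0 h1 (σ j)) m
  · intro i _ hi
    have : flipAt j σ i = σ i := by simp [flipAt, hi]
    simp_rw [this, Real.sqrt_mul_self (coinMass_nonneg (hb0 _) (hb1 _) _)]
    simp [coinMass]
  · simp


/-! ### Bernoulli value distributions -/

/-- The values `0` and `1` as elements of a value space. -/
def bit {A : Set ℝ} (hA : {0, 1} ⊆ A) (b : Bool) : A :=
  if b then ⟨1, hA (by simp)⟩ else ⟨0, hA (by simp)⟩

lemma bit_injective {A : Set ℝ} (hA : {0, 1} ⊆ A) : Function.Injective (bit hA) := by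
  intro a b h
  cases a <;> cases b <;> simp_all [bit]

/-- The distribution of a coin showing `true` with probability `p`. -/
noncomputable def coin (p : ℝ) : Measure Bool :=
  ENNReal.ofReal (coinMass p true) • Measure.dirac true +
    ENNReal.ofReal (coinMass p false) • Measure.dirac false

instance (p : ℝ) : IsFiniteMeasure (coin p) := by
  constructor
  simp [coin]

lemma coin_singleton (p : ℝ) (b : Bool) : coin p {b} = ENNReal.ofReal (coinMass p b) := by
  cases b <;> simp [coin]

lemma isProbabilityMeasure_coin {p : ℝ} (h0 : 0 ≤ p) (h1 : p ≤ 1) :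
    IsProbabilityMeasure (coin p) := by
  constructor
  simp only [coin, coinMass, if_true, Bool.false_eq_true, if_false, Measure.add_apply,
    Measure.smul_apply, measure_univ, smul_eq_mul, mul_one]
  rw [← ENNReal.ofReal_add h0 (by linarith)]
  simp

lemma integral_coin {p : ℝ} (h0 : 0 ≤ p) (h1 : p ≤ 1) (g : Bool → ℝ) :
    ∫ b, g b ∂(coin p) = p * g true + (1 - p) * g false := by
  rw [integral_fintype Integrable.of_finite]
  simp [measureReal_def, coin_singleton, coinMass, h0, h1]

lemma pi_coin_singleton {ι κ : Type*} [Fintype ι] [Fintype κ] {p : ι → ℝ} (h0 : ∀ j, 0 ≤ p j)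
    (h1 : ∀ j, p j ≤ 1) (S : κ → ι → Bool) :
    (Measure.pi fun _ : κ => Measure.pi fun j => coin (p j)).real {S} = sampleMass p S := by
  simp only [measureReal_def, Measure.pi_singleton, ENNReal.toReal_prod, coin_singleton, sampleMass]
  exact Finset.prod_congr rfl fun k _ => Finset.prod_congr rfl fun j _ =>
    ENNReal.toReal_ofReal (coinMass_nonneg (h0 j) (h1 j) _)

variable {n : ℕ} {T : Fin n → Set ℝ} {H : ℝ}

/-- The product value distribution under which bidder `i` has value `1` with probability `p i`
and value `0` otherwise. -/
noncomputable def bernoulliMarginals (hT : ∀ i, {0, 1} ⊆ T i) (p : Fin n → ℝ) (h0 : ∀ i, 0 ≤ p i)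
    (h1 : ∀ i, p i ≤ 1) : Marginals T := fun i =>
  ⟨(coin (p i)).map (bit (hT i)),
    haveI := isProbabilityMeasure_coin (h0 i) (h1 i)
    Measure.isProbabilityMeasure_map (measurable_of_finite _).aemeasurable⟩

lemma isBernoulliType_bernoulliMarginals (hT : ∀ i, {0, 1} ⊆ T i) (p : Fin n → ℝ)
    (h0 : ∀ i, 0 ≤ p i) (h1 : ∀ i, p i ≤ 1) :
    IsBernoulliType (bernoulliMarginals hT p h0 h1) := by
  intro i
  have hm : MeasurableSet {v : T i | (v : ℝ) = 0 ∨ (v : ℝ) = 1} :=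
    (measurable_subtype_coe (measurableSet_singleton 0)).union
      (measurable_subtype_coe (measurableSet_singleton 1))
  refine (ae_map_iff (measurable_of_finite _).aemeasurable hm).2 (Filter.Eventually.of_forall ?_)
  intro b
  cases b <;> simp [bit]

lemma measurableEmbedding_of_finite {α β : Type*} [MeasurableSpace α] [MeasurableSpace β]
    [Finite α] [MeasurableSingletonClass α] [MeasurableSingletonClass β] {f : α → β}
    (hf : Function.Injective f) : MeasurableEmbedding f :=
  ⟨hf, measurable_of_finite f, fun {s} _ => ((Set.toFinite s).image f).measurableSet⟩

lemma jointDist_bernoulliMarginals (hT : ∀ i, {0, 1} ⊆ T i) (p : Fin n → ℝ) (h0 : ∀ i, 0 ≤ p i)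
    (h1 : ∀ i, p i ≤ 1) :
    jointDist (bernoulliMarginals hT p h0 h1) =
      (Measure.pi fun i => coin (p i)).map (fun x i => bit (hT i) (x i)) :=
  (Measure.pi_map_pi fun _ => (measurable_of_finite _).aemeasurable).symm

lemma opponentsDist_bernoulliMarginals (hT : ∀ i, {0, 1} ⊆ T i) (p : Fin n → ℝ)
    (h0 : ∀ i, 0 ≤ p i) (h1 : ∀ i, p i ≤ 1) (i : Fin n) :
    opponentsDist (bernoulliMarginals hT p h0 h1) i =
      (Measure.pi fun j : {j : Fin n // j ≠ i} => coin (p j)).map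
        (fun (x : {j : Fin n // j ≠ i} → Bool) (j : {j : Fin n // j ≠ i}) =>
          bit (hT j) (x j)) :=
  (Measure.pi_map_pi fun _ => (measurable_of_finite _).aemeasurable).symm

open Classical in
-- The set `G` need not be measurable: the bits embed measurably as a finite set, so its measure can
-- be computed on bit arrays.
lemma sum_sampleMass_of_estimates (hT : ∀ i, {0, 1} ⊆ T i) {p : Fin n → ℝ} (h0 : ∀ i, 0 ≤ p i)
    (h1 : ∀ i, p i ≤ 1) {m : ℕ} (G : Set (Fin m → Values T)) {δ : ℝ}
    (hG : ENNReal.ofReal (1 - δ) ≤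
      (Measure.pi fun _ : Fin m => jointDist (bernoulliMarginals hT p h0 h1)) G) :
    1 - δ ≤ ∑ S : Fin m → Fin n → Bool with (fun k i => bit (hT i) (S k i)) ∈ G,
      sampleMass p S := by
  have hmap : (Measure.pi fun _ : Fin m => jointDist (bernoulliMarginals hT p h0 h1)) =
      (Measure.pi fun _ : Fin m => Measure.pi fun i => coin (p i)).map
        (fun S k i => bit (hT i) (S k i)) := by
    simp_rw [jointDist_bernoulliMarginals]
    exact (Measure.pi_map_pi (f := fun _ (x : Fin n → Bool) i => bit (hT i) (x i))
      fun _ => (measurable_of_finite _).aemeasurable).symm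
  have hinj : Function.Injective
      (fun (S : Fin m → Fin n → Bool) k i => bit (hT i) (S k i)) := by
    intro S S' h
    funext k i
    exact bit_injective (hT i) (congrFun (congrFun h k) i)
  rw [hmap, (measurableEmbedding_of_finite hinj).map_apply,
    ENNReal.ofReal_le_iff_le_toReal (measure_ne_top _ _), ← measureReal_def] at hG
  refine hG.trans_eq ?_
  simp_rw [← pi_coin_singleton h0 h1]
  rw [sum_measureReal_singleton]
  congr 1
  ext S
  simp

/-! ### Utilities under threshold strategies -/

/-- The joint strategy in which bidder `i₀` bids `1/2`, every bidder in `J` bids `1` if her value is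
at least `1`, and all other bids are `0`. -/
noncomputable def thresholdStrategy (T : Fin n → Set ℝ) (hH : 1 ≤ H) (i₀ : Fin n)
    (J : Finset (Fin n)) : JointStrategy T H := fun j t =>
  if j = i₀ then ⟨1 / 2, by norm_num, by linarith⟩
  else if j ∈ J ∧ 1 ≤ (t : ℝ) then ⟨1, by norm_num, hH⟩
  else ⟨0, le_rfl, by linarith⟩

lemma thresholdStrategy_mem (hH : 1 ≤ H) (i₀ : Fin n) (J : Finset (Fin n)) :
    thresholdStrategy T hH i₀ J ∈ monotoneStrategies T H := by
  intro j t t' h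
  have h' : (t : ℝ) ≤ t' := h
  unfold thresholdStrategy
  split_ifs with h1 h2 h3 h3
  · exact le_rfl
  · exact le_rfl
  · exact absurd ⟨h2.1, h2.2.trans h'⟩ h3
  · exact Subtype.mk_le_mk.2 zero_le_one
  · exact le_rfl

lemma exPostUtility_one_of_forall {i₀ : Fin n} {b : Fin n → ℝ} (h0 : b i₀ = 1 / 2)
    (h : ∀ j, j ≠ i₀ → b j = 0) : exPostUtility i₀ 1 b = 1 / 2 := by
  have hle : ∀ j, b j ≤ 1 / 2 := fun j => by
    rcases eq_or_ne j i₀ with rfl | hj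
    · exact h0.le
    · rw [h j hj]; norm_num
  have hfil : (Finset.univ.filter fun k => ∀ j, b j ≤ b k) = {i₀} := by
    ext k
    simp only [Finset.mem_filter, Finset.mem_univ, true_and, Finset.mem_singleton]
    constructor
    · intro hk
      by_contra hne
      have := hk i₀
      rw [h k hne, h0] at this
      norm_num at this
    · rintro rfl j
      rw [h0]; exact hle j
  have : alloc b i₀ = 1 := by
    rw [alloc, hfil, if_pos fun j => by rw [h0]; exact hle j]
    simp
  rw [exPostUtility, payment, this, h0]
  norm_num

lemma exPostUtility_of_exists_lt {i₀ : Fin n} {b : Fin n → ℝ} (v : ℝ) (h : ∃ j, b i₀ < b j) :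
    exPostUtility i₀ v b = 0 := by
  obtain ⟨j, hj⟩ := h
  have : alloc b i₀ = 0 := if_neg fun hall => absurd (hall j) hj.not_ge
  simp [exPostUtility, payment, this]

/-- The event that nobody in `J` outbids `1/2` is written as a product of indicators, so that
independence factors its expectation. -/
lemma exPostUtility_thresholdStrategy (hT : ∀ i, {0, 1} ⊆ T i) (hH : 1 ≤ H) (i₀ : Fin n)
    (J : Finset (Fin n)) (x : {j : Fin n // j ≠ i₀} → Bool) :
    exPostUtility i₀ 1 (bidsAgainst i₀ (1 / 2) (thresholdStrategy T hH i₀ J)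
      fun j : {j : Fin n // j ≠ i₀} => bit (hT j) (x j)) =
      1 / 2 * ∏ j : {j : Fin n // j ≠ i₀}, if (j : Fin n) ∈ J ∧ x j = true then 0 else 1 := by
  by_cases h : ∃ j : {j : Fin n // j ≠ i₀}, (j : Fin n) ∈ J ∧ x j = true
  · obtain ⟨j, hj⟩ := h
    have hz : (∏ j : {j : Fin n // j ≠ i₀},
        if (j : Fin n) ∈ J ∧ x j = true then (0 : ℝ) else 1) = 0 :=
      Finset.prod_eq_zero (Finset.mem_univ j) (if_pos hj)
    rw [hz, mul_zero]
    refine exPostUtility_of_exists_lt 1 ⟨j, ?_⟩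
    simp only [bidsAgainst, thresholdStrategy, bit, hj, j.2, dif_pos, dif_neg, not_false_iff]
    norm_num
  · push Not at h
    rw [exPostUtility_one_of_forall, Finset.prod_eq_one, mul_one]
    · exact fun j _ => if_neg fun hj => h j hj.1 hj.2
    · simp [bidsAgainst]
    · intro j hj
      have := h ⟨j, hj⟩
      by_cases hJ : j ∈ J
      · have hx : x ⟨j, hj⟩ = false := by simpa using this hJ
        simp [bidsAgainst, thresholdStrategy, bit, hj, hx, not_le.2 (zero_lt_one' ℝ)]
      · simp [bidsAgainst, thresholdStrategy, hj, hJ]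

lemma interimUtility_thresholdStrategy (hT : ∀ i, {0, 1} ⊆ T i) (hH : 1 ≤ H) {p : Fin n → ℝ}
    (h0 : ∀ i, 0 ≤ p i) (h1 : ∀ i, p i ≤ 1) {i₀ : Fin n} {J : Finset (Fin n)} (hJ : i₀ ∉ J) :
    interimUtility (bernoulliMarginals hT p h0 h1) i₀ 1 (1 / 2) (thresholdStrategy T hH i₀ J) =
      1 / 2 * ∏ j ∈ J, (1 - p j) := by
  have hinj : Function.Injective
      (fun (x : {j : Fin n // j ≠ i₀} → Bool) (j : {j : Fin n // j ≠ i₀}) =>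
        bit (hT j) (x j)) := by
    intro x y h
    funext j
    exact bit_injective (hT j) (congrFun h j)
  rw [interimUtility, opponentsDist_bernoulliMarginals,
    (measurableEmbedding_of_finite hinj).integral_map]
  simp_rw [exPostUtility_thresholdStrategy hT hH]
  rw [integral_const_mul]
  congr 1
  rw [integral_fintype_prod_eq_prod
    (f := fun (j : {j : Fin n // j ≠ i₀}) (b : Bool) =>
      if (j : Fin n) ∈ J ∧ b = true then (0 : ℝ) else 1)]
  have e : ∀ j : {j : Fin n // j ≠ i₀},
      ∫ b, (if (j : Fin n) ∈ J ∧ b = true then (0 : ℝ) else 1) ∂(coin (p j)) =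
      if (j : Fin n) ∈ J then 1 - p j else 1 := fun j => by
    rw [integral_coin (h0 _) (h1 _)]
    by_cases hj : (j : Fin n) ∈ J <;> simp [hj]
  rw [Finset.prod_congr rfl fun j _ => e j]
  rw [← Finset.prod_subtype (p := fun j => j ≠ i₀) (Finset.univ.erase i₀) (by simp)
    (fun j => if j ∈ J then 1 - p j else 1), Finset.prod_ite_mem]
  congr 1
  ext j
  simp only [Finset.mem_inter, Finset.mem_erase, Finset.mem_univ, and_true]
  exact ⟨fun h => h.2, fun h => ⟨fun e => hJ (e ▸ h), h⟩⟩



/-! ### Decoding the signs and the contradiction -/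

lemma card_mul_le_prod_sub_prod (hn : 1 ≤ n) {θ : ℝ} (h0 : 0 ≤ θ) (h1 : θ ≤ 1 / 4)
    {σ τ : Fin n → Bool} {J : Finset (Fin n)} (hσ : ∀ j ∈ J, σ j = true)
    (hτ : ∀ j ∈ J, τ j = false) :
    J.card / 4 * (2 * θ / n) ≤ ∏ j ∈ J, (1 - bias n θ (τ j)) - ∏ j ∈ J, (1 - bias n θ (σ j)) := by
  have hn' : (1 : ℝ) ≤ n := by exact_mod_cast hn
  have eσ : ∏ j ∈ J, (1 - bias n θ (σ j)) = (1 - bias n θ true) ^ J.card :=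
    Finset.prod_eq_pow_card fun j hj => by rw [hσ j hj]
  have eτ : ∏ j ∈ J, (1 - bias n θ (τ j)) = (1 - bias n θ false) ^ J.card :=
    Finset.prod_eq_pow_card fun j hj => by rw [hτ j hj]
  rw [eσ, eτ]
  have hd : (1 - bias n θ false) - (1 - bias n θ true) = 2 * θ / n := by
    simp only [bias, if_true, Bool.false_eq_true, if_false]
    field_simp
    ring
  have hpos : 0 ≤ 2 * θ / n := by positivity
  have hb0 := bias_nonneg (n := n) h0 h1 true
  have hb1 := bias_le_one hn h0 h1 true
  rw [← hd]
  refine div_four_mul_le_pow_sub_pow (n := n) (by linarith) (by linarith) (by linarith) ?_ ?_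
  -- Since `n * bias = 1/2 + θ ≤ 3/4`, Bernoulli's inequality keeps even the full product above
  -- `1/4`.
  · calc (1 : ℝ) / 4 ≤ 1 + n * -bias n θ true := by
          have : (n : ℝ) * bias n θ true = 1 / 2 + θ := by
            simp only [bias, if_true]; field_simp
          linarith
      _ ≤ (1 + -bias n θ true) ^ n := one_add_mul_le_pow (by linarith) n
      _ = _ := by rw [← sub_eq_add_neg]
  · simpa using J.card_le_univ

/-- The member of the hard family with signs `σ`. -/
noncomputable def hardMarginals (hT : ∀ i, {0, 1} ⊆ T i) (hn : 1 ≤ n) {θ : ℝ} (h0 : 0 ≤ θ)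
    (h1 : θ ≤ 1 / 4) (σ : Fin n → Bool) : Marginals T :=
  bernoulliMarginals hT (fun i => bias n θ (σ i)) (fun _ => bias_nonneg h0 h1 _)
    (fun _ => bias_le_one hn h0 h1 _)

/-- If the same estimates are accurate for two members of the hard family, then their signs differ
in few coordinates. -/
lemma card_ne_le_of_mem_goodSamples (hT : ∀ i, {0, 1} ⊆ T i) (hH : 1 ≤ H) (hn : 1 ≤ n) {θ ε : ℝ}
    (h0 : 0 ≤ θ) (h1 : θ ≤ 1 / 4) {m : ℕ} (A : UtilityEstimator T H m) {S : Fin m → Values T}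
    {σ τ : Fin n → Bool}
    (hσ : S ∈ goodSamples A (monotoneStrategies T H) ε (hardMarginals hT hn h0 h1 σ))
    (hτ : S ∈ goodSamples A (monotoneStrategies T H) ε (hardMarginals hT hn h0 h1 τ))
    (i₀ : Fin n) :
    ((Finset.univ.erase i₀).filter fun j => τ j ≠ σ j).card * θ ≤ 16 * ε * n := by
  have hn' : (0 : ℝ) < n := by exact_mod_cast hn
  have close : ∀ J : Finset (Fin n), i₀ ∉ J →
      |∏ j ∈ J, (1 - bias n θ (τ j)) - ∏ j ∈ J, (1 - bias n θ (σ j))| ≤ 4 * ε := by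
    intro J hJ
    have e1 := hσ _ (thresholdStrategy_mem hH i₀ J) i₀ (bit (hT i₀) true)
    have e2 := hτ _ (thresholdStrategy_mem hH i₀ J) i₀ (bit (hT i₀) true)
    have hb : ((thresholdStrategy T hH i₀ J i₀ (bit (hT i₀) true) : Set.Icc (0 : ℝ) H) : ℝ) =
        1 / 2 := by simp [thresholdStrategy]
    have hv : ((bit (hT i₀) true : T i₀) : ℝ) = 1 := by simp [bit]
    rw [hb, hv, hardMarginals, interimUtility_thresholdStrategy hT hH _ _ hJ, abs_lt] at e1 e2
    rw [abs_le]
    constructor <;> linarith [e1.1, e1.2, e2.1, e2.2]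
  have half : ∀ {α β : Fin n → Bool} {J : Finset (Fin n)}, (∀ j ∈ J, α j = true) →
      (∀ j ∈ J, β j = false) →
      |∏ j ∈ J, (1 - bias n θ (β j)) - ∏ j ∈ J, (1 - bias n θ (α j))| ≤ 4 * ε →
      J.card * θ ≤ 8 * ε * n := by
    intro α β J hα hβ h
    have h2 := (card_mul_le_prod_sub_prod hn h0 h1 hα hβ).trans ((le_abs_self _).trans h)
    have e : (J.card : ℝ) / 4 * (2 * θ / n) = J.card * θ / 2 / n := by field_simp; norm_num
    rw [e, div_le_iff₀ hn'] at h2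
    linarith
  -- Disagreements of opposite direction could cancel in one product, so each direction gets its own
  -- `J`.
  have hsplit : ((Finset.univ.erase i₀).filter fun j => τ j ≠ σ j) =
      ((Finset.univ.erase i₀).filter fun j => σ j = true ∧ τ j = false) ∪
      ((Finset.univ.erase i₀).filter fun j => τ j = true ∧ σ j = false) := by
    ext j
    simp only [Finset.mem_union, Finset.mem_filter]
    cases σ j <;> cases τ j <;> simp
  have c1 := half (α := σ) (β := τ)
    (J := (Finset.univ.erase i₀).filter fun j => σ j = true ∧ τ j = false)
    (fun j hj => (Finset.mem_filter.1 hj).2.1) (fun j hj => (Finset.mem_filter.1 hj).2.2)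
    (close _ (by simp))
  have c2 := half (α := τ) (β := σ)
    (J := (Finset.univ.erase i₀).filter fun j => τ j = true ∧ σ j = false)
    (fun j hj => (Finset.mem_filter.1 hj).2.1) (fun j hj => (Finset.mem_filter.1 hj).2.2)
    (by rw [abs_sub_comm]; exact close _ (by simp))
  have hc : (((Finset.univ.erase i₀).filter fun j => τ j ≠ σ j).card : ℝ) ≤
      ((Finset.univ.erase i₀).filter fun j => σ j = true ∧ τ j = false).card +
      ((Finset.univ.erase i₀).filter fun j => τ j = true ∧ σ j = false).card := by
    rw [hsplit]
    exact_mod_cast Finset.card_union_le _ _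
  nlinarith [mul_le_mul_of_nonneg_right hc h0]

/-- Here `d` will be the number of decoding errors: small on good samples, and bounded trivially on
the rest. -/
lemma sum_mul_le_of_good {X : Type*} [Fintype X] {P d : X → ℝ} (hP : ∀ x, 0 ≤ P x)
    (hP1 : ∑ x, P x = 1) (G : X → Prop) [DecidablePred G] {a b δ : ℝ} (ha : 0 ≤ a) (hb : 0 ≤ b)
    (hG : 1 - δ ≤ ∑ x with G x, P x) (hda : ∀ x, G x → d x ≤ a) (hdb : ∀ x, d x ≤ b) :
    ∑ x, P x * d x ≤ a + δ * b := by
  have hs := Finset.sum_filter_add_sum_filter_not Finset.univ G P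
  rw [hP1] at hs
  calc ∑ x, P x * d x = ∑ x with G x, P x * d x + ∑ x with ¬G x, P x * d x :=
        (Finset.sum_filter_add_sum_filter_not _ _ _).symm
    _ ≤ ∑ x with G x, P x * a + ∑ x with ¬G x, P x * b := by
        gcongr with x hx x hx
        · exact hP x
        · exact hda x (Finset.mem_filter.1 hx).2
        · exact hP x
        · exact hdb x
    _ = (∑ x with G x, P x) * a + (∑ x with ¬G x, P x) * b := by
        rw [Finset.sum_mul, Finset.sum_mul]
    _ ≤ 1 * a + δ * b := by
        have hn : 0 ≤ ∑ x with ¬G x, P x := Finset.sum_nonneg fun x _ => hP x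
        gcongr <;> linarith
    _ = a + δ * b := by rw [one_mul]

open Classical in
lemma not_estimatesUtilities_hardMarginals (hT : ∀ i, {0, 1} ⊆ T i) (hH : 1 ≤ H) (hn : 2 ≤ n)
    {ε δ : ℝ} (hε : 0 < ε) (h0 : 0 ≤ 400 * ε) (h1 : 400 * ε ≤ 1 / 4) (hδ' : δ < 1 / 20) {m : ℕ}
    (hm : (m : ℝ) ≤ 1 / (4 * 10 ^ 8) * (n / ε ^ 2)) (A : UtilityEstimator T H m) :
    ¬ EstimatesUtilities A
      (Set.range (hardMarginals hT (one_le_two.trans hn) h0 h1)) (monotoneStrategies T H) ε δ := by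
  intro hA
  have hn1 : 1 ≤ n := one_le_two.trans hn
  have hn' : (2 : ℝ) ≤ n := by exact_mod_cast hn
  let i₀ : Fin n := ⟨0, by omega⟩
  let good (σ : Fin n → Bool) (S : Fin m → Fin n → Bool) : Prop :=
    (fun k i => bit (hT i) (S k i)) ∈
      goodSamples A (monotoneStrategies T H) ε (hardMarginals hT hn1 h0 h1 σ)
  -- The decoder picks any sign vector for which the estimates are accurate. Its default value
  -- matters only on samples that are bad for the true `σ`.
  let dec (S : Fin m → Fin n → Bool) : Fin n → Bool :=
    if h : ∃ σ, good σ S then h.choose else fun _ => false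
  let P (σ : Fin n → Bool) (S : Fin m → Fin n → Bool) : ℝ :=
    sampleMass (fun i => bias n (400 * ε) (σ i)) S
  have hP : ∀ σ S, 0 ≤ P σ S := fun σ S =>
    sampleMass_nonneg (fun _ => bias_nonneg h0 h1 _) (fun _ => bias_le_one hn1 h0 h1 _) S
  have hP1 : ∀ σ, ∑ S, P σ S = 1 := fun σ => sum_sampleMass _
  have hsmall : m * (4 * (400 * ε) ^ 2 / n) ≤ 1 / 625 := by
    have : m * (4 * (400 * ε) ^ 2 / n) = 640000 * (ε ^ 2 / n) * m := by ring
    rw [this]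
    calc 640000 * (ε ^ 2 / n) * m ≤ 640000 * (ε ^ 2 / n) * (1 / (4 * 10 ^ 8) * (n / ε ^ 2)) := by
          gcongr
      _ = 1 / 625 := by field_simp; norm_num
  have lower := assouad P hP hP1 (c := 1 - 1 / 625) (by norm_num)
    (fun σ j => (sub_le_sub_left hsmall 1).trans (affinity_sampleMass hn1 h0 h1 σ j)) dec
    (Finset.univ.erase i₀)
  have upper : ∀ σ, ∑ S, P σ S * ((Finset.univ.erase i₀).filter fun j => dec S j ≠ σ j).card ≤
      n / 25 + δ * n := by
    intro σ
    refine sum_mul_le_of_good (hP σ) (hP1 σ) (good σ) (by positivity) (by positivity)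
      (sum_sampleMass_of_estimates hT _ _ _ (hA _ ⟨σ, rfl⟩)) (fun S hS => ?_) (fun S => ?_)
    · have hex : ∃ τ, good τ S := ⟨σ, hS⟩
      have hdec : good (dec S) S := by
        simp only [dec, dif_pos hex]
        exact hex.choose_spec
      have := card_ne_le_of_mem_goodSamples hT hH hn1 h0 h1 A hS hdec i₀
      nlinarith
    · exact_mod_cast (Finset.card_le_univ _).trans_eq (Fintype.card_fin n)
  have total := lower.trans (Finset.sum_le_sum fun σ _ => upper σ)
  rw [Finset.sum_const, Finset.card_univ, nsmul_eq_mul] at total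
  have hcard : (0 : ℝ) < Fintype.card (Fin n → Bool) := by exact_mod_cast Fintype.card_pos
  have h2 := le_of_mul_le_mul_left total hcard
  rw [Finset.card_erase_of_mem (Finset.mem_univ _), Finset.card_univ, Fintype.card_fin,
    Nat.cast_sub hn1, Nat.cast_one] at h2
  -- With `n - 1 ≥ n/2`, the lower bound `(n - 1)(624/625)²/4` exceeds `0.12n`, while the upper
  -- bound `n/25 + δn` is below `0.09n`.
  nlinarith

end FirstPrice

theorem mainTheorem3 (n : ℕ) (hn : 2 ≤ n) (H : ℝ) (T : Fin n → Set ℝ)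
    (hT : ∀ i, T i ⊆ Set.Icc 0 H) (hT01 : ∀ i, {0, 1} ⊆ T i)
    (ε δ : ℝ) (hε : 0 < ε) (hε' : ε < 1 / 4000) (hδ : 0 < δ) (hδ' : δ < 1 / 20) :
    ∃ 𝓕 : Set (FirstPrice.Marginals T),
      (∀ F ∈ 𝓕, FirstPrice.IsBernoulliType F) ∧
      ∀ m : ℕ, (m : ℝ) ≤ 1 / (4 * 10 ^ 8) * (n / ε ^ 2) →
        ∀ A : FirstPrice.UtilityEstimator T H m,
          ¬ FirstPrice.EstimatesUtilities A 𝓕 (FirstPrice.monotoneStrategies T H) ε δ := by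
  have hH : 1 ≤ H := (hT ⟨0, by omega⟩ (hT01 _ (by simp : (1 : ℝ) ∈ ({0, 1} : Set ℝ)))).2
  have h1 : 400 * ε ≤ 1 / 4 := by linarith
  refine ⟨Set.range (FirstPrice.hardMarginals hT01 (one_le_two.trans hn) (by positivity) h1), ?_,
    fun m hm A =>
      FirstPrice.not_estimatesUtilities_hardMarginals hT01 hH hn hε (by positivity) h1 hδ' hm A⟩
  rintro _ ⟨σ, rfl⟩
  exact FirstPrice.isBernoulliType_bernoulliMarginals hT01 _ _ _
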